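/- A status-update system evolves in time slots $t=1,2,\dots$. Its state is $s=(v_1,v_2)$, where $v_1\in\{1,2,\dots\}$ is the age of the monitor and either $v_2\in\{1,\dots,v_1\}$ is the age of the packet held by the transmitter, or $v_2=\infty$, meaning that the transmitter holds no packet. In each slot the sampler observes the state and chooses $a\in\{0,1\}$ ($a=1$: sample a fresh packet, which replaces the one held; $a=0$: do not sample). Whenever the transmitter holds a packet it transmits it, and the transmission succeeds with probability $q\in(0,1]$, independently of everything else. Thus the transitions are: - for $a=1$ in any state: $(v_1,v_2)\to(1,\infty)$ with probability $q$, and $\to(v_1+1,1)$ with probability $1-q$; - for $a=0$ and $v_2<\infty$: $(v_1,v_2)\to(v_2+1,\infty)$ with probability $q$, and $\to(v_1+1,v_2+1)$ with probability $1-q$; - for $a=0$ and $v_2=\infty$: $(v_1,\infty)\to(v_1+1,\infty)$ with probability $1$. For $\lambda\ge 0$ let $C_1(s,a;\lambda)=v_1+\lambda\mathbf 1_{\{a=1\}}$, and for a policy $\pi$ let $$J_T(\pi)=\frac1T\sum_{t=1}^T\mathbb E_\pi\big[C_1(s(t),a(t);\lambda)\,\big|\,s(1)=(1,\infty)\big].$$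 A stationary policy is a deterministic map $f$ from states to actions, used in every slot. A Bernoulli-modulated simple policy chooses before the first slot, with probabilities $p$ and $1-p$ for some $0<p<1$, one of two stationary policies $f,g$ for which there is a state $s'$ such that $f(s)=g(s)$ for all $s\neq s'$, and uses the chosen one forever. Let $\Pi_1$ be the set of these policies. **Theorem.** For every $q\in(0,1]$ and every $\lambda\ge0$ there is a stationary policy $f$ that is optimal for the Lagrangian average-cost problem: the limit $L=\lim_{T\to\infty}J_T(f)$ exists and is finite, and $$L=\inf_{\pi\in\Pi_1}\limsup_{T\to\infty}J_T(\pi).$$ Moreover $L\le\liminf_{T\to\infty}J_T(\pi)$ for every policy $\pi$, including all randomized and history-dependent ones, so that $f$ is optimal among all policies. -/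

import Mathlib

open Filter Topology
open scoped NNReal ENNReal

namespace AgeSampling

/-- The states of the system. `withPacket v₁ v₂ h` is the state `(v₁, v₂)`: the age of the monitor
is `v₁` and the transmitter holds a packet of age `v₂ ≤ v₁`. `noPacket v₁` is the state `(v₁, ∞)`:
the age of the monitor is `v₁` and the transmitter holds no packet. -/
inductive State where
  | withPacket (v₁ v₂ : ℕ+) (h : v₂ ≤ v₁) : State
  | noPacket (v₁ : ℕ+) : State

/-- The sampling decision in a slot: `true` is action `1` (sample), `false` is action `0`. -/
abbrev Action : Type := Bool

/-- The age of the monitor, i.e. the first coordinate of the state. -/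
def State.age : State → ℕ+
  | .withPacket v₁ _ _ => v₁
  | .noPacket v₁ => v₁

/-- A coin that shows `true` with probability `p` and `false` with probability `1 - p`. -/
noncomputable def coin (p : ℝ≥0) (hp : p ≤ 1) : PMF Bool :=
  PMF.ofFintype (fun b => ((if b then p else 1 - p : ℝ≥0) : ℝ≥0∞)) (by
    rw [Fintype.sum_bool, ← ENNReal.coe_add]
    simp [hp])

/-- The transition law. A transmission, which takes place whenever the transmitter holds a packet
(possibly the one just sampled), succeeds with probability `q`.
* Action `1` in any state: success leads to `(1, ∞)`, failure to `(v₁ + 1, 1)`.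
* Action `0` in `(v₁, v₂)`: success leads to `(v₂ + 1, ∞)`, failure to `(v₁ + 1, v₂ + 1)`.
* Action `0` in `(v₁, ∞)`: nothing is transmitted and the next state is `(v₁ + 1, ∞)`. -/
noncomputable def step (q : ℝ≥0) (hq : q ≤ 1) : State → Action → PMF State
  | s, true => (coin q hq).map fun success =>
      if success then .noPacket 1 else .withPacket (s.age + 1) 1 one_le
  | .withPacket v₁ v₂ h, false => (coin q hq).map fun success =>
      if success then .noPacket (v₂ + 1)
      else .withPacket (v₁ + 1) (v₂ + 1) (add_le_add_left h 1)
  | .noPacket v₁, false => PMF.pure (.noPacket (v₁ + 1))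

/-- The Lagrangian cost `C₁(s, a; lam) = v₁ + lam * 1_{a = 1}`. -/
def cost (lam : ℝ≥0) (s : State) (a : Action) : ℝ≥0 :=
  (s.age : ℝ≥0) + if a = true then lam else 0

/-- A (causal, randomized, history-dependent) sampling policy. A seed is drawn before the first
slot; then the action of each slot is drawn from a distribution that depends on the seed, the list
of all earlier state-action pairs, and the current state. -/
structure Policy where
  Seed : Type
  seed : PMF Seed
  act : Seed → List (State × Action) → State → PMF Action

/-- Joint law of the past state-action pairs (in chronological order) and the current state after
`n` slots, i.e. at time `n + 1`, given the seed and the initial state `s₁`. -/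
noncomputable def histLaw (q : ℝ≥0) (hq : q ≤ 1) (s₁ : State) (π : Policy) (ω : π.Seed) :
    ℕ → PMF (List (State × Action) × State)
  | 0 => PMF.pure ([], s₁)
  | n + 1 => (histLaw q hq s₁ π ω n).bind fun x =>
      (π.act ω x.1 x.2).bind fun a =>
        (step q hq x.2 a).map fun s' => (x.1 ++ [(x.2, a)], s')

/-- The law of the pair `(s(t), a(t))` at time `t = n + 1` under `π`, given `s(1) = s₁`. -/
noncomputable def stateActionLaw (q : ℝ≥0) (hq : q ≤ 1) (s₁ : State) (π : Policy) (n : ℕ) :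
    PMF (State × Action) :=
  π.seed.bind fun ω => (histLaw q hq s₁ π ω n).bind fun x =>
    (π.act ω x.1 x.2).map fun a => (x.2, a)

/-- `E_π[C₁(s(t), a(t); lam) | s(1) = s₁]` at time `t = n + 1`. -/
noncomputable def expectedCost (q : ℝ≥0) (hq : q ≤ 1) (lam : ℝ≥0) (s₁ : State) (π : Policy)
    (n : ℕ) : ℝ≥0∞ :=
  ∑' x : State × Action, stateActionLaw q hq s₁ π n x * (cost lam x.1 x.2 : ℝ≥0∞)

/-- `(1 / T) * ∑_{t = 1}^{T} E_π[C₁(s(t), a(t); lam) | s(1) = (1, ∞)]`. -/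
noncomputable def averageCost (q : ℝ≥0) (hq : q ≤ 1) (lam : ℝ≥0) (π : Policy) (T : ℕ) : ℝ≥0∞ :=
  (∑ n ∈ Finset.range T, expectedCost q hq lam (.noPacket 1) π n) / (T : ℝ≥0∞)

/-- The stationary deterministic policy that takes action `f s` in state `s`. -/
noncomputable def stationaryPolicy (f : State → Action) : Policy where
  Seed := Unit
  seed := PMF.pure ()
  act _ _ s := PMF.pure (f s)

/-- Choose, once and for all before the first slot, the stationary policy `f` with probability `p`
and the stationary policy `g` with probability `1 - p`. -/
noncomputable def mixedPolicy (p : ℝ≥0) (hp : p ≤ 1) (f g : State → Action) : Policy where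
  Seed := Bool
  seed := coin p hp
  act b _ s := PMF.pure (if b then f s else g s)

/-- The Bernoulli-modulated simple policies: a mixture, with weight `0 < p < 1`, of two stationary
policies that agree off a single state. -/
def bernoulliModulatedSimple : Set Policy :=
  {π | ∃ (p : ℝ≥0) (_ : 0 < p) (hp : p < 1) (f g : State → Action) (s' : State),
    (∀ s, s ≠ s' → f s = g s) ∧ π = mixedPolicy p hp.le f g}

end AgeSampling

namespace AgeSampling

/-! The proof solves the average-cost optimality equation `L + H s = min_a (C₁ s a + E H s')`
explicitly. If one samples in every slot, a success takes `1/q` slots on average, which suggests the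
value `age/q` up to a constant. So take `H = age/q + B - saving`, where the saving over sampling at
once depends only on the index: the packet's age, or the monitor's age if no packet is held. With `L
= x + 1/q`, a slot without sampling at index `k` gains `x - k`, hence pays off exactly when `k < x`.
This yields recursions for the savings `d` (no packet) and `e` (packet held). Sampling costs `lam`
and amounts to holding a packet of age `0`, so consistency requires `e 0 = lam`; the intermediate
value theorem supplies such an `x`. The minimizer is the threshold rule "sample when the index is at
least `x`" (`exists_optimality_equation`).

Summing the equation over time bounds the total cost from below by `T * L` minus the mean of `H` at
the horizon, for any policy. `H` is unbounded, but the age grows by at most one per slot and is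
itself part of the cost, so either the total cost is already at least `T * L` or the mean age is
`O(√T)` (`le_totalCost`). Along the threshold policy the mean of `H` stays bounded, so the total
cost is `T * L + O(1)` (`totalCost_stationary`). -/

/-! ### Savings functions -/

/-- Sum of a function of finite support with geometric weights. -/
lemma geomSum_shift (r : ℝ) (φ : ℕ → ℝ) (N : ℕ) (hφ : ∀ k, N ≤ k → φ k = 0) (k : ℕ) :
    ∑ j ∈ Finset.range N, r ^ j * φ (k + j) =
      φ k + r * ∑ j ∈ Finset.range N, r ^ j * φ (k + 1 + j) := by
  have h1 : ∑ j ∈ Finset.range (N + 1), r ^ j * φ (k + j) =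
      ∑ j ∈ Finset.range N, r ^ j * φ (k + j) := by
    rw [Finset.sum_range_succ, hφ (k + N) (by omega)]
    simp
  rw [← h1, Finset.sum_range_succ', Finset.mul_sum, add_comm]
  simp only [pow_zero, one_mul, add_zero]
  congr 1
  refine Finset.sum_congr rfl fun j _ => ?_
  rw [pow_succ, show k + (j + 1) = k + 1 + j by ring]
  ring

/-- What the best waiting time saves, compared with sampling at once, if the transmitter holds no
packet and the age of the monitor is `k`. -/
noncomputable def waitSaving (N : ℕ) (x : ℝ) (k : ℕ) : ℝ :=
  ∑ i ∈ Finset.range N, (1 : ℝ) ^ i * max 0 (x - ((k + i : ℕ) : ℝ))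

/-- What retransmitting a packet of age `k` saves, compared with sampling at once. -/
noncomputable def holdSaving (q : ℝ) (N : ℕ) (x : ℝ) (k : ℕ) : ℝ :=
  ∑ j ∈ Finset.range N,
    (1 - q) ^ j * (max 0 (x - ((k + j : ℕ) : ℝ)) + q * waitSaving N x (k + j + 1))

lemma ramp_eq_zero {x : ℝ} {k : ℕ} (h : x ≤ k) : max 0 (x - (k : ℝ)) = 0 :=
  max_eq_left (by linarith)

lemma waitSaving_nonneg (N : ℕ) (x : ℝ) (k : ℕ) : 0 ≤ waitSaving N x k :=
  Finset.sum_nonneg fun i _ => by positivity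

lemma holdSaving_nonneg {q : ℝ} (hq0 : 0 ≤ q) (hq1 : q ≤ 1) (N : ℕ) (x : ℝ) (k : ℕ) :
    0 ≤ holdSaving q N x k :=
  Finset.sum_nonneg fun i _ => by
    have := waitSaving_nonneg N x (k + i + 1)
    have : 0 ≤ 1 - q := by linarith
    positivity

lemma waitSaving_eq_zero (N : ℕ) {x : ℝ} {k : ℕ} (h : x ≤ k) : waitSaving N x k = 0 :=
  Finset.sum_eq_zero fun i _ => by
    rw [ramp_eq_zero (h.trans (by exact_mod_cast Nat.le_add_right k i)), mul_zero]

lemma holdSaving_eq_zero (q : ℝ) (N : ℕ) {x : ℝ} {k : ℕ} (h : x ≤ k) :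
    holdSaving q N x k = 0 :=
  Finset.sum_eq_zero fun i _ => by
    rw [ramp_eq_zero (h.trans (by exact_mod_cast Nat.le_add_right k i)),
      waitSaving_eq_zero N (h.trans (by exact_mod_cast (by omega : k ≤ k + i + 1)))]
    simp

/-- The truncation at `N` is harmless because all terms with index at least `x` vanish. The factor
`1 ^ i` in `waitSaving` lets `geomSum_shift` serve both recursions, with ratios `1` and `1 - q`. -/
lemma waitSaving_rec {N : ℕ} {x : ℝ} (hx : x ≤ N) (k : ℕ) :
    waitSaving N x k = max 0 (x - k) + waitSaving N x (k + 1) := by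
  have := geomSum_shift 1 (fun k => max 0 (x - (k : ℝ))) N
    (fun k hk => ramp_eq_zero (hx.trans (by exact_mod_cast hk))) k
  rw [one_mul] at this
  exact this

lemma holdSaving_rec (q : ℝ) {N : ℕ} {x : ℝ} (hx : x ≤ N) (k : ℕ) :
    holdSaving q N x k =
      max 0 (x - k) + q * waitSaving N x (k + 1) + (1 - q) * holdSaving q N x (k + 1) :=
  geomSum_shift (1 - q) (fun k => max 0 (x - (k : ℝ)) + q * waitSaving N x (k + 1)) N
    (fun k hk => by
      have hk : x ≤ k := hx.trans (by exact_mod_cast hk)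
      rw [ramp_eq_zero hk, waitSaving_eq_zero N (hk.trans (by norm_num))]
      simp) k

/-- The threshold `x` is sought in `[0, lam]`. Fixing `N ≥ lam` beforehand gives one finite sum for
all these `x`, hence continuity. At `x = 0` the saving is `0`; at `x = lam` its first term alone is
`lam`. -/
lemma exists_savings {q lam : ℝ} (hq0 : 0 ≤ q) (hq1 : q ≤ 1) (hlam : 0 ≤ lam) :
    ∃ (x B : ℝ) (d e : ℕ → ℝ), 0 ≤ x ∧ (∀ k, 0 ≤ d k) ∧ (∀ k, 0 ≤ e k) ∧
      (∀ k, d k ≤ B) ∧ (∀ k, e k ≤ B) ∧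
      (∀ k : ℕ, x ≤ k → d k = 0) ∧ (∀ k : ℕ, x ≤ k → e k = 0) ∧
      (∀ k, d k = max 0 (x - k) + d (k + 1)) ∧
      (∀ k, e k = max 0 (x - k) + q * d (k + 1) + (1 - q) * e (k + 1)) ∧
      e 0 = lam := by
  obtain ⟨N, hN⟩ := exists_nat_ge lam
  have hcont : ContinuousOn (fun x => holdSaving q N x 0) (Set.Icc 0 lam) := by
    unfold holdSaving waitSaving
    fun_prop
  have hmem : lam ∈ Set.Icc (holdSaving q N 0 0) (holdSaving q N lam 0) := by
    refine ⟨by rw [holdSaving_eq_zero q N (by simp)]; exact hlam, ?_⟩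
    rw [holdSaving_rec q hN]
    have h1 := le_max_right 0 (lam - ((0 : ℕ) : ℝ))
    have h2 := mul_nonneg hq0 (waitSaving_nonneg N lam (0 + 1))
    have h3 := mul_nonneg (sub_nonneg.2 hq1) (holdSaving_nonneg hq0 hq1 N lam (0 + 1))
    simp only [Nat.cast_zero, sub_zero] at h1 ⊢
    linarith
  obtain ⟨x, hx, hroot⟩ := intermediate_value_Icc hlam hcont hmem
  have hxN : x ≤ N := hx.2.trans hN
  have hbound : ∀ φ : ℕ → ℝ, (∀ k, 0 ≤ φ k) → (∀ k : ℕ, x ≤ k → φ k = 0) →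
      ∀ k, φ k ≤ ∑ i ∈ Finset.range N, φ i := by
    intro φ h0 hz k
    rcases lt_or_ge k N with hk | hk
    · exact Finset.single_le_sum (fun i _ => h0 i) (Finset.mem_range.2 hk)
    · rw [hz k (hxN.trans (by exact_mod_cast hk))]
      exact Finset.sum_nonneg fun i _ => h0 i
  -- The bound `B` is left to unification: it becomes the maximum of the two finite sums from
  -- `hbound`.
  exact ⟨x, _, waitSaving N x, holdSaving q N x, hx.1, waitSaving_nonneg N x,
    holdSaving_nonneg hq0 hq1 N x,
    fun k => (hbound _ (waitSaving_nonneg N x) (fun k => waitSaving_eq_zero N) k).trans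
      (le_max_left _ _),
    fun k => (hbound _ (holdSaving_nonneg hq0 hq1 N x) (fun k => holdSaving_eq_zero q N) k).trans
      (le_max_right _ _),
    fun k => waitSaving_eq_zero N, fun k => holdSaving_eq_zero q N,
    waitSaving_rec hxN, holdSaving_rec q hxN, hroot⟩

/-! ### Expectations -/

/-- Expectation of an extended nonnegative function. -/
noncomputable def expect {α : Type*} (p : PMF α) (φ : α → ℝ≥0∞) : ℝ≥0∞ := ∑' a, p a * φ a

section expect

variable {α β : Type*}

lemma expect_pure (a : α) (φ : α → ℝ≥0∞) : expect (PMF.pure a) φ = φ a := by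
  unfold expect
  rw [tsum_eq_single a]
  · simp
  · intro b hb
    simp [PMF.pure_apply, hb]

lemma expect_bind (p : PMF α) (f : α → PMF β) (φ : β → ℝ≥0∞) :
    expect (p.bind f) φ = expect p fun a => expect (f a) φ := by
  simp only [expect, PMF.bind_apply, ← ENNReal.tsum_mul_right, ← ENNReal.tsum_mul_left]
  rw [ENNReal.tsum_comm]
  simp only [mul_assoc]

lemma expect_map (p : PMF α) (f : α → β) (φ : β → ℝ≥0∞) :
    expect (p.map f) φ = expect p fun a => φ (f a) := by
  rw [← PMF.bind_pure_comp, expect_bind]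
  simp only [Function.comp_apply, expect_pure]

lemma expect_mono (p : PMF α) {φ ψ : α → ℝ≥0∞} (h : ∀ a, φ a ≤ ψ a) :
    expect p φ ≤ expect p ψ :=
  ENNReal.tsum_le_tsum fun a => by gcongr; exact h a

lemma expect_add (p : PMF α) (φ ψ : α → ℝ≥0∞) :
    expect p (fun a => φ a + ψ a) = expect p φ + expect p ψ := by
  simp only [expect, mul_add, ENNReal.tsum_add]

lemma expect_const (p : PMF α) (c : ℝ≥0∞) : expect p (fun _ => c) = c := by
  simp only [expect, ENNReal.tsum_mul_right, p.tsum_coe, one_mul]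

lemma expect_const_mul (p : PMF α) (c : ℝ≥0∞) (φ : α → ℝ≥0∞) :
    expect p (fun a => c * φ a) = c * expect p φ := by
  simp only [expect, ← ENNReal.tsum_mul_left]
  exact tsum_congr fun a => by ring

end expect

lemma expect_coin (q : ℝ≥0) (hq : q ≤ 1) (φ : Bool → ℝ≥0∞) :
    expect (coin q hq) φ = q * φ true + ((1 - q : ℝ≥0) : ℝ≥0∞) * φ false := by
  simp [expect, coin, tsum_fintype]

lemma expect_coin_ofReal (q : ℝ≥0) (hq : q ≤ 1) {φ : Bool → ℝ} (hφ : ∀ b, 0 ≤ φ b) :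
    expect (coin q hq) (fun b => ENNReal.ofReal (φ b)) =
      ENNReal.ofReal (q * φ true + (1 - q) * φ false) := by
  have hq' : (0 : ℝ) ≤ 1 - q := sub_nonneg.2 (by exact_mod_cast hq)
  rw [expect_coin, ENNReal.ofReal_add (mul_nonneg q.coe_nonneg (hφ _)) (mul_nonneg hq' (hφ _)),
    ENNReal.ofReal_mul q.coe_nonneg, ENNReal.ofReal_mul hq', ENNReal.ofReal_coe_nnreal]
  congr 2

/-! ### The optimality equation -/

/-- The age on which the threshold policy bases its decision. -/
def State.index : State → ℕ+
  | .withPacket _ v₂ _ => v₂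
  | .noPacket v₁ => v₁

/-- The threshold policy: sample as soon as the index of the state is at least `x`. -/
noncomputable def thresholdPolicy (x : ℝ) (s : State) : Action :=
  decide (x ≤ ((s.index : ℕ) : ℝ))

/-- The saving in a state, given the savings `d` without and `e` with a packet. -/
def State.saving (d e : ℕ → ℝ) : State → ℝ
  | .withPacket _ v₂ _ => e v₂
  | .noPacket v₁ => d v₁

/-- The relative value function. -/
noncomputable def relValue (q B : ℝ) (d e : ℕ → ℝ) (s : State) : ℝ :=
  ((s.age : ℕ) : ℝ) / q + B - s.saving d e

section optimality

variable {q : ℝ≥0} {lam : ℝ≥0} {x B : ℝ} {d e : ℕ → ℝ}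

lemma relValue_ge (hdB : ∀ k, d k ≤ B) (heB : ∀ k, e k ≤ B) (q : ℝ) (s : State) :
    ((s.age : ℕ) : ℝ) / q ≤ relValue q B d e s := by
  have : s.saving d e ≤ B := by cases s <;> simp only [State.saving, hdB, heB]
  unfold relValue
  linarith

lemma relValue_le (hd : ∀ k, 0 ≤ d k) (he : ∀ k, 0 ≤ e k) (q : ℝ) (s : State) :
    relValue q B d e s ≤ ((s.age : ℕ) : ℝ) / q + B := by
  have : 0 ≤ s.saving d e := by cases s <;> simp only [State.saving, hd, he]
  unfold relValue
  linarith

/-- The shift by `B` serves only this purpose: with nonnegative values all expectations can be taken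
in `ℝ≥0∞`, without integrability conditions. -/
lemma relValue_nonneg (hdB : ∀ k, d k ≤ B) (heB : ∀ k, e k ≤ B) (q : ℝ≥0) (s : State) :
    0 ≤ relValue q B d e s :=
  (by positivity : (0 : ℝ) ≤ ((s.age : ℕ) : ℝ) / q).trans (relValue_ge hdB heB q s)

/-- Expectation of a real function of the next state. -/
noncomputable def nextValue (q : ℝ) (φ : State → ℝ) : State → Action → ℝ
  | s, true => q * φ (.noPacket 1) + (1 - q) * φ (.withPacket (s.age + 1) 1 one_le)
  | .withPacket v₁ v₂ h, false => q * φ (.noPacket (v₂ + 1)) +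
      (1 - q) * φ (.withPacket (v₁ + 1) (v₂ + 1) (add_le_add_left h 1))
  | .noPacket v₁, false => φ (.noPacket (v₁ + 1))

lemma expect_step (hq1 : q ≤ 1) {φ : State → ℝ} (hφ : ∀ s, 0 ≤ φ s) (s : State) (a : Action) :
    expect (step q hq1 s a) (fun s' => ENNReal.ofReal (φ s')) =
      ENNReal.ofReal (nextValue q φ s a) := by
  rcases s with ⟨v₁, v₂, h⟩ | v₁ <;> cases a <;> simp only [step, nextValue]
  case noPacket.false => rw [expect_pure]
  all_goals
    rw [expect_map, expect_coin_ofReal q hq1 fun b => hφ _]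
    rfl

lemma nextValue_nonneg (hq1 : q ≤ 1) {φ : State → ℝ} (hφ : ∀ s, 0 ≤ φ s) (s : State)
    (a : Action) : 0 ≤ nextValue q φ s a := by
  have hq' : (0 : ℝ) ≤ 1 - q := sub_nonneg.2 (by exact_mod_cast hq1)
  rcases s with ⟨v₁, v₂, h⟩ | v₁ <;> cases a <;> simp only [nextValue]
  case noPacket.false => exact hφ _
  all_goals exact add_nonneg (mul_nonneg q.coe_nonneg (hφ _)) (mul_nonneg hq' (hφ _))

/-- The excess of sampling over the optimum is the forgone saving, which vanishes once the index
reaches `x`. The recursion for `e` at `0`, with `e 0 = lam`, is what cancels the sampling cost. -/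
lemma cost_add_nextValue_sample (hq0 : 0 < q) (hx : 0 ≤ x)
    (her : ∀ k, e k = max 0 (x - k) + q * d (k + 1) + (1 - q) * e (k + 1)) (he0 : e 0 = lam)
    (s : State) :
    (cost lam s true : ℝ) + nextValue q (relValue q B d e) s true =
      x + 1 / q + relValue q B d e s + s.saving d e := by
  have hq : (0 : ℝ) < q := by exact_mod_cast hq0
  have h0 := her 0
  rw [he0, Nat.cast_zero, sub_zero, max_eq_right hx, zero_add] at h0
  simp only [nextValue, relValue, State.saving, State.age, cost, if_true, PNat.add_coe,
    PNat.one_coe]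
  push_cast
  field_simp
  linear_combination (q : ℝ) * h0

/-- The excess of not sampling is the positive part of `index - x`, so it vanishes exactly when the
index is at most `x`. -/
lemma cost_add_nextValue_wait (hq0 : 0 < q)
    (hdr : ∀ k, d k = max 0 (x - k) + d (k + 1))
    (her : ∀ k, e k = max 0 (x - k) + q * d (k + 1) + (1 - q) * e (k + 1)) (s : State) :
    (cost lam s false : ℝ) + nextValue q (relValue q B d e) s false =
      x + 1 / q + relValue q B d e s +
        (max 0 (x - ((s.index : ℕ) : ℝ)) - (x - ((s.index : ℕ) : ℝ))) := by
  have hq : (0 : ℝ) < q := by exact_mod_cast hq0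
  rcases s with ⟨v₁, v₂, h⟩ | v₁
  · have h0 := her v₂
    simp only [nextValue, relValue, State.saving, State.age, State.index, cost, PNat.add_coe,
      PNat.one_coe]
    push_cast [Bool.false_eq_true, if_false]
    field_simp
    linear_combination (q : ℝ) * h0
  · have h0 := hdr v₁
    simp only [nextValue, relValue, State.saving, State.age, State.index, cost, PNat.add_coe,
      PNat.one_coe]
    push_cast [Bool.false_eq_true, if_false]
    field_simp
    linear_combination (q : ℝ) * h0

end optimality

/-- The average-cost optimality equation: for the gain `L` there are a relative value function `H`
of linear growth in the age and a stationary policy `f` that attains the minimum. -/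
lemma exists_optimality_equation {q : ℝ≥0} (hq0 : 0 < q) (hq1 : q ≤ 1) (lam : ℝ≥0) :
    ∃ (L B : ℝ) (H : State → ℝ) (f : State → Action), 0 ≤ L ∧ 0 ≤ B ∧
      (∀ s, 0 ≤ H s) ∧ (∀ s, H s ≤ ((s.age : ℕ) : ℝ) / q + B) ∧
      (∀ s a, ENNReal.ofReal L + ENNReal.ofReal (H s) ≤ (cost lam s a : ℝ≥0∞) +
        expect (step q hq1 s a) fun s' => ENNReal.ofReal (H s')) ∧
      ∀ s, ENNReal.ofReal L + ENNReal.ofReal (H s) = (cost lam s (f s) : ℝ≥0∞) +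
        expect (step q hq1 s (f s)) fun s' => ENNReal.ofReal (H s') := by
  obtain ⟨x, B, d, e, hx, hd, he, hdB, heB, hdz, hez, hdr, her, he0⟩ :=
    exists_savings (q := q) (lam := lam) q.coe_nonneg (by exact_mod_cast hq1) lam.coe_nonneg
  have hL : 0 ≤ x + 1 / (q : ℝ) := by positivity
  have hH := relValue_nonneg hdB heB q
  have hsum : ∀ s a, (cost lam s a : ℝ≥0∞) +
        expect (step q hq1 s a) (fun s' => ENNReal.ofReal (relValue q B d e s')) =
      ENNReal.ofReal (cost lam s a + nextValue q (relValue q B d e) s a) := by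
    intro s a
    rw [expect_step hq1 hH, ENNReal.ofReal_add (NNReal.coe_nonneg _)
      (nextValue_nonneg hq1 hH s a), ENNReal.ofReal_coe_nnreal]
  refine ⟨x + 1 / q, B, relValue q B d e, thresholdPolicy x, hL, (hd 0).trans (hdB 0), hH,
    relValue_le hd he q, fun s a => ?_, fun s => ?_⟩
  · rw [hsum, ← ENNReal.ofReal_add hL (hH s)]
    refine ENNReal.ofReal_le_ofReal ?_
    cases a
    · rw [cost_add_nextValue_wait hq0 hdr her]
      have := le_max_right 0 (x - ((s.index : ℕ) : ℝ))
      linarith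
    · rw [cost_add_nextValue_sample hq0 hx her he0]
      have : 0 ≤ s.saving d e := by cases s <;> simp only [State.saving, hd, he]
      linarith
  · rw [hsum, ← ENNReal.ofReal_add hL (hH s)]
    congr 1
    by_cases h : x ≤ ((s.index : ℕ) : ℝ)
    · rw [thresholdPolicy, decide_eq_true h, cost_add_nextValue_sample hq0 hx her he0]
      have : s.saving d e = 0 := by
        cases s
        · exact hez _ h
        · exact hdz _ h
      linarith
    · rw [thresholdPolicy, decide_eq_false h, cost_add_nextValue_wait hq0 hdr her,
        max_eq_right (by linarith)]
      ring

/-! ### Expectations along a policy -/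

section policy

variable (q : ℝ≥0) (hq1 : q ≤ 1) (lam : ℝ≥0) (π : Policy)

/-- Expectation of a function of the state after `n` slots. -/
noncomputable def stateExpect (n : ℕ) (φ : State → ℝ≥0∞) : ℝ≥0∞ :=
  expect (stateActionLaw q hq1 (.noPacket 1) π n) fun x => φ x.1

lemma expect_stateActionLaw (n : ℕ) (φ : State × Action → ℝ≥0∞) :
    expect (stateActionLaw q hq1 (.noPacket 1) π n) φ =
      expect π.seed fun ω => expect (histLaw q hq1 (.noPacket 1) π ω n) fun x =>
        expect (π.act ω x.1 x.2) fun a => φ (x.2, a) := by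
  simp only [stateActionLaw, expect_bind, expect_map]

lemma stateExpect_eq (n : ℕ) (φ : State → ℝ≥0∞) :
    stateExpect q hq1 π n φ = expect π.seed fun ω =>
      expect (histLaw q hq1 (.noPacket 1) π ω n) fun x => φ x.2 := by
  simp only [stateExpect, expect_stateActionLaw, expect_const]

lemma stateExpect_zero (φ : State → ℝ≥0∞) :
    stateExpect q hq1 π 0 φ = φ (.noPacket 1) := by
  simp only [stateExpect_eq, histLaw, expect_pure, expect_const]

lemma stateExpect_succ (n : ℕ) (φ : State → ℝ≥0∞) :
    stateExpect q hq1 π (n + 1) φ =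
      expect (stateActionLaw q hq1 (.noPacket 1) π n) fun x =>
        expect (step q hq1 x.1 x.2) φ := by
  simp only [stateExpect_eq, expect_stateActionLaw, histLaw, expect_bind, expect_map]

lemma expectedCost_eq (n : ℕ) :
    expectedCost q hq1 lam (.noPacket 1) π n =
      expect (stateActionLaw q hq1 (.noPacket 1) π n) fun x => (cost lam x.1 x.2 : ℝ≥0∞) :=
  rfl

/-- Expected age after `n` slots. -/
noncomputable def expectedAge (n : ℕ) : ℝ≥0∞ :=
  stateExpect q hq1 π n fun s => ((s.age : ℕ) : ℝ≥0∞)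

lemma expect_step_age_le (s : State) (a : Action) :
    expect (step q hq1 s a) (fun s' => ((s'.age : ℕ) : ℝ≥0∞)) ≤ ((s.age : ℕ) : ℝ≥0∞) + 1 := by
  have key : ∀ f : Bool → State, (∀ b, ((f b).age : ℕ) ≤ s.age + 1) →
      expect ((coin q hq1).map f) (fun s' => ((s'.age : ℕ) : ℝ≥0∞)) ≤
        ((s.age : ℕ) : ℝ≥0∞) + 1 := by
    intro f hf
    rw [expect_map]
    refine (expect_mono _ fun b => ?_).trans (expect_const (coin q hq1) _).le
    exact_mod_cast hf b
  rcases s with ⟨v₁, v₂, h⟩ | v₁ <;> cases a <;> simp only [step]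
  case noPacket.false =>
    rw [expect_pure]
    simp [State.age]
  case withPacket.false =>
    refine key _ fun b => ?_
    -- The constraint `v₂ ≤ v₁` matters here: delivery of the old packet sets the monitor's age to
    -- `v₂ + 1`, which must not exceed `v₁ + 1`.
    have : (v₂ : ℕ) ≤ v₁ := h
    cases b <;> simp [State.age, this]
  all_goals
    refine key _ fun b => ?_
    cases b <;> simp [State.age]

lemma expectedAge_zero : expectedAge q hq1 π 0 = 1 := by
  simp [expectedAge, stateExpect_zero, State.age]

lemma expectedAge_succ_le (n : ℕ) : expectedAge q hq1 π (n + 1) ≤ expectedAge q hq1 π n + 1 := by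
  rw [expectedAge, stateExpect_succ]
  refine (expect_mono _ fun (x : State × Action) => expect_step_age_le q hq1 x.1 x.2).trans ?_
  rw [expect_add, expect_const]
  rfl

lemma expectedAge_ne_top (n : ℕ) : expectedAge q hq1 π n ≠ ⊤ := by
  induction n with
  | zero => simp [expectedAge_zero]
  | succ n ih =>
    exact ((expectedAge_succ_le q hq1 π n).trans_lt
      (ENNReal.add_lt_top.2 ⟨ih.lt_top, ENNReal.one_lt_top⟩)).ne

lemma expectedAge_le_expectedCost (n : ℕ) :
    expectedAge q hq1 π n ≤ expectedCost q hq1 lam (.noPacket 1) π n := by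
  rw [expectedCost_eq]
  refine expect_mono _ fun x => ?_
  simp [cost]

lemma expectedCost_ne_top (n : ℕ) : expectedCost q hq1 lam (.noPacket 1) π n ≠ ⊤ := by
  have : expectedCost q hq1 lam (.noPacket 1) π n ≤ expectedAge q hq1 π n + lam := by
    rw [expectedCost_eq, expectedAge, stateExpect, ← expect_const
      (stateActionLaw q hq1 (.noPacket 1) π n) (lam : ℝ≥0∞), ← expect_add]
    refine expect_mono _ fun x => ?_
    rw [cost, ENNReal.coe_add]
    gcongr
    · simp
    · split_ifs <;> simp
  exact (this.trans_lt (ENNReal.add_lt_top.2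
    ⟨(expectedAge_ne_top q hq1 π n).lt_top, ENNReal.coe_lt_top⟩)).ne

/-- Expected total cost of the first `T` slots. -/
noncomputable def totalCost (T : ℕ) : ℝ :=
  ∑ n ∈ Finset.range T, (expectedCost q hq1 lam (.noPacket 1) π n).toReal

lemma averageCost_eq (T : ℕ) (hT : 0 < T) :
    averageCost q hq1 lam π T = ENNReal.ofReal (totalCost q hq1 lam π T / T) := by
  rw [averageCost, totalCost, ENNReal.ofReal_div_of_pos (by exact_mod_cast hT),
    ENNReal.ofReal_sum_of_nonneg fun _ _ => ENNReal.toReal_nonneg, ENNReal.ofReal_natCast]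
  simp only [ENNReal.ofReal_toReal (expectedCost_ne_top q hq1 lam π _)]

/-- The mean age is controlled by the square root of the accumulated cost. -/
lemma expectedAge_sq_le (T : ℕ) :
    (expectedAge q hq1 π T).toReal ^ 2 ≤ 1 + T + 2 * totalCost q hq1 lam π T := by
  induction T with
  | zero => simp [expectedAge_zero, totalCost]
  | succ n ih =>
    have h1 : (expectedAge q hq1 π (n + 1)).toReal ≤ (expectedAge q hq1 π n).toReal + 1 := by
      have := ENNReal.toReal_mono
        (ENNReal.add_ne_top.2 ⟨expectedAge_ne_top q hq1 π n, ENNReal.one_ne_top⟩)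
        (expectedAge_succ_le q hq1 π n)
      rwa [ENNReal.toReal_add (expectedAge_ne_top q hq1 π n) ENNReal.one_ne_top,
        ENNReal.toReal_one] at this
    have h2 := ENNReal.toReal_mono (expectedCost_ne_top q hq1 lam π n)
      (expectedAge_le_expectedCost q hq1 lam π n)
    -- Squaring `m (n + 1) ≤ m n + 1` adds `2 * m n + 1`, and the mean age `m n` is at most the
    -- expected cost of that slot.
    have h3 := pow_le_pow_left₀ ENNReal.toReal_nonneg h1 2
    have h4 : totalCost q hq1 lam π (n + 1) = totalCost q hq1 lam π n +
        (expectedCost q hq1 lam (.noPacket 1) π n).toReal := Finset.sum_range_succ _ _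
    rw [h4]
    push_cast
    linarith [add_sq (expectedAge q hq1 π n).toReal 1]

/-- Real-valued expectation of a nonnegative function of the state after `n` slots. -/
noncomputable def stateMean (H : State → ℝ) (n : ℕ) : ℝ :=
  (stateExpect q hq1 π n fun s => ENNReal.ofReal (H s)).toReal

variable {q lam}

lemma stateExpect_le_of_linear (hq0 : 0 < q) {B : ℝ} (hB : 0 ≤ B) {H : State → ℝ}
    (hHB : ∀ s, H s ≤ ((s.age : ℕ) : ℝ) / q + B) (n : ℕ) :
    stateExpect q hq1 π n (fun s => ENNReal.ofReal (H s)) ≤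
      ENNReal.ofReal (1 / q) * expectedAge q hq1 π n + ENNReal.ofReal B := by
  rw [expectedAge, stateExpect, stateExpect, ← expect_const
    (stateActionLaw q hq1 (.noPacket 1) π n) (ENNReal.ofReal B), ← expect_const_mul, ← expect_add]
  refine expect_mono _ fun y => ?_
  rw [← ENNReal.ofReal_natCast, ← ENNReal.ofReal_mul (by positivity),
    ← ENNReal.ofReal_add (by positivity) hB]
  refine ENNReal.ofReal_le_ofReal ((hHB y.1).trans (le_of_eq ?_))
  ring

lemma stateExpect_ne_top_of_linear (hq0 : 0 < q) {B : ℝ} (hB : 0 ≤ B) {H : State → ℝ}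
    (hHB : ∀ s, H s ≤ ((s.age : ℕ) : ℝ) / q + B) (n : ℕ) :
    stateExpect q hq1 π n (fun s => ENNReal.ofReal (H s)) ≠ ⊤ :=
  ((stateExpect_le_of_linear hq1 π hq0 hB hHB n).trans_lt (ENNReal.add_lt_top.2
    ⟨ENNReal.mul_lt_top ENNReal.ofReal_lt_top (expectedAge_ne_top q hq1 π n).lt_top,
      ENNReal.ofReal_lt_top⟩)).ne

lemma stateMean_le (hq0 : 0 < q) {B : ℝ} (hB : 0 ≤ B) {H : State → ℝ}
    (hHB : ∀ s, H s ≤ ((s.age : ℕ) : ℝ) / q + B) (n : ℕ) :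
    stateMean q hq1 π H n ≤ (expectedAge q hq1 π n).toReal / q + B := by
  have hfin : ENNReal.ofReal (1 / q) * expectedAge q hq1 π n ≠ ⊤ :=
    ENNReal.mul_ne_top ENNReal.ofReal_ne_top (expectedAge_ne_top q hq1 π n)
  refine (ENNReal.toReal_mono (ENNReal.add_ne_top.2 ⟨hfin, ENNReal.ofReal_ne_top⟩)
    (stateExpect_le_of_linear hq1 π hq0 hB hHB n)).trans (le_of_eq ?_)
  rw [ENNReal.toReal_add hfin ENNReal.ofReal_ne_top, ENNReal.toReal_mul,
    ENNReal.toReal_ofReal hB, ENNReal.toReal_ofReal (by positivity)]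
  ring

/-- An inequality in the optimality equation, in expectation. -/
lemma add_stateMean_le (hq0 : 0 < q) {L B : ℝ} (hL : 0 ≤ L) (hB : 0 ≤ B) {H : State → ℝ}
    (hHB : ∀ s, H s ≤ ((s.age : ℕ) : ℝ) / q + B)
    (h : ∀ s a, ENNReal.ofReal L + ENNReal.ofReal (H s) ≤ (cost lam s a : ℝ≥0∞) +
        expect (step q hq1 s a) fun s' => ENNReal.ofReal (H s')) (n : ℕ) :
    L + stateMean q hq1 π H n ≤ (expectedCost q hq1 lam (.noPacket 1) π n).toReal +
      stateMean q hq1 π H (n + 1) := by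
  have hfin := stateExpect_ne_top_of_linear hq1 π hq0 hB hHB
  have key : ENNReal.ofReal L + stateExpect q hq1 π n (fun s => ENNReal.ofReal (H s)) ≤
      expectedCost q hq1 lam (.noPacket 1) π n +
        stateExpect q hq1 π (n + 1) (fun s => ENNReal.ofReal (H s)) := by
    rw [stateExpect_succ, expectedCost_eq, ← expect_add, stateExpect, ← expect_const
      (stateActionLaw q hq1 (.noPacket 1) π n) (ENNReal.ofReal L), ← expect_add]
    exact expect_mono _ fun y => h y.1 y.2
  have := ENNReal.toReal_mono
    (ENNReal.add_ne_top.2 ⟨expectedCost_ne_top q hq1 lam π n, hfin (n + 1)⟩) key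
  rwa [ENNReal.toReal_add ENNReal.ofReal_ne_top (hfin n), ENNReal.toReal_ofReal hL,
    ENNReal.toReal_add (expectedCost_ne_top q hq1 lam π n) (hfin (n + 1))] at this

/-- The optimality equation, in expectation, along the minimizing stationary policy. -/
lemma add_stateMean_stationary (hq0 : 0 < q) {L B : ℝ} (hL : 0 ≤ L) (hB : 0 ≤ B)
    {H : State → ℝ} (hHB : ∀ s, H s ≤ ((s.age : ℕ) : ℝ) / q + B) {f : State → Action}
    (h : ∀ s, ENNReal.ofReal L + ENNReal.ofReal (H s) = (cost lam s (f s) : ℝ≥0∞) +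
        expect (step q hq1 s (f s)) fun s' => ENNReal.ofReal (H s')) (n : ℕ) :
    L + stateMean q hq1 (stationaryPolicy f) H n =
      (expectedCost q hq1 lam (.noPacket 1) (stationaryPolicy f) n).toReal +
        stateMean q hq1 (stationaryPolicy f) H (n + 1) := by
  have hfin := stateExpect_ne_top_of_linear hq1 (stationaryPolicy f) hq0 hB hHB
  have key : ENNReal.ofReal L +
        stateExpect q hq1 (stationaryPolicy f) n (fun s => ENNReal.ofReal (H s)) =
      expectedCost q hq1 lam (.noPacket 1) (stationaryPolicy f) n +
        stateExpect q hq1 (stationaryPolicy f) (n + 1) (fun s => ENNReal.ofReal (H s)) := by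
    rw [stateExpect_succ, expectedCost_eq, ← expect_add, stateExpect, ← expect_const
      (stateActionLaw q hq1 (.noPacket 1) (stationaryPolicy f) n) (ENNReal.ofReal L),
      -- The equality `h` is available only for the action `f s`, so the action law must be unfolded
      -- before `h` applies.
      ← expect_add, expect_stateActionLaw, expect_stateActionLaw]
    simp only [stationaryPolicy, expect_pure, h]
  have := congrArg ENNReal.toReal key
  rwa [ENNReal.toReal_add ENNReal.ofReal_ne_top (hfin n), ENNReal.toReal_ofReal hL,
    ENNReal.toReal_add (expectedCost_ne_top q hq1 lam _ n) (hfin (n + 1))] at this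

/-- The telescoped inequality leaves the mean of `H` at time `T`, at most the mean age over `q` plus
`B`. If the total cost exceeds `T * L` nothing is to be shown; otherwise `expectedAge_sq_le` bounds
the mean age by the square root. -/
lemma le_totalCost (hq0 : 0 < q) {L B : ℝ} (hL : 0 ≤ L) (hB : 0 ≤ B) {H : State → ℝ}
    (hHB : ∀ s, H s ≤ ((s.age : ℕ) : ℝ) / q + B)
    (h : ∀ s a, ENNReal.ofReal L + ENNReal.ofReal (H s) ≤ (cost lam s a : ℝ≥0∞) +
        expect (step q hq1 s a) fun s' => ENNReal.ofReal (H s')) (T : ℕ) :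
    T * L - B - √(1 + T + 2 * (T * L)) / q ≤ totalCost q hq1 lam π T := by
  have htel : T * L + stateMean q hq1 π H 0 ≤
      totalCost q hq1 lam π T + stateMean q hq1 π H T := by
    induction T with
    | zero => simp [totalCost]
    | succ n ih =>
      have h4 : totalCost q hq1 lam π (n + 1) = totalCost q hq1 lam π n +
        (expectedCost q hq1 lam (.noPacket 1) π n).toReal := Finset.sum_range_succ _ _
      have := add_stateMean_le hq1 π hq0 hL hB hHB h n
      rw [h4]
      push_cast
      linarith
  have h0 : 0 ≤ stateMean q hq1 π H 0 := ENNReal.toReal_nonneg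
  rcases le_total (T * L) (totalCost q hq1 lam π T) with hc | hc
  · have : 0 ≤ √(1 + T + 2 * (T * L)) / q := by positivity
    linarith
  · have hage : (expectedAge q hq1 π T).toReal ≤ √(1 + T + 2 * (T * L)) :=
      Real.le_sqrt_of_sq_le ((expectedAge_sq_le q hq1 lam π T).trans (by linarith))
    have hm := stateMean_le hq1 π hq0 hB hHB T
    have : (expectedAge q hq1 π T).toReal / q ≤ √(1 + T + 2 * (T * L)) / q := by gcongr
    linarith

/-- The optimality equation is its own drift condition. Writing `h n` for the mean of `H`, the
expected cost is at least the mean age, hence at least `q * (h n - B)`, so `h (n + 1) ≤ (1 - q) * h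
n + L + q * B`. This contraction keeps `h` bounded, and telescoping finishes. -/
lemma totalCost_stationary (hq0 : 0 < q) {L B : ℝ} (hL : 0 ≤ L) (hB : 0 ≤ B)
    {H : State → ℝ} (hHB : ∀ s, H s ≤ ((s.age : ℕ) : ℝ) / q + B) {f : State → Action}
    (h : ∀ s, ENNReal.ofReal L + ENNReal.ofReal (H s) = (cost lam s (f s) : ℝ≥0∞) +
        expect (step q hq1 s (f s)) fun s' => ENNReal.ofReal (H s')) :
    ∃ K, ∀ T : ℕ, |totalCost q hq1 lam (stationaryPolicy f) T - T * L| ≤ K := by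
  set π := stationaryPolicy f
  have hq : (0 : ℝ) < q := by exact_mod_cast hq0
  have hq1' : (q : ℝ) ≤ 1 := by exact_mod_cast hq1
  have hstep := add_stateMean_stationary hq1 hq0 hL hB hHB h
  have hpos : ∀ n, 0 ≤ stateMean q hq1 π H n := fun n => ENNReal.toReal_nonneg
  -- The second condition makes `[0, K]` invariant under `h ↦ (1 - q) * h + L + q * B`.
  obtain ⟨K, hK0, hK1⟩ : ∃ K, stateMean q hq1 π H 0 ≤ K ∧ L + q * B ≤ q * K :=
    ⟨max (stateMean q hq1 π H 0) ((L + q * B) / q), le_max_left _ _, by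
      have := le_max_right (stateMean q hq1 π H 0) ((L + q * B) / q)
      rwa [div_le_iff₀' hq] at this⟩
  have hbdd : ∀ n, stateMean q hq1 π H n ≤ K := by
    intro n
    induction n with
    | zero => exact hK0
    | succ n ih =>
      have h1 := hstep n
      have h2 := ENNReal.toReal_mono (expectedCost_ne_top q hq1 lam π n)
        (expectedAge_le_expectedCost q hq1 lam π n)
      have h3 := stateMean_le hq1 π hq0 hB hHB n
      have h4 := mul_le_mul_of_nonneg_left h3 hq.le
      rw [mul_add, mul_div_cancel₀ _ hq.ne'] at h4
      have h5 := mul_le_mul_of_nonneg_left ih (sub_nonneg.2 hq1')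
      linarith
  have htel : ∀ T : ℕ, T * L + stateMean q hq1 π H 0 =
      totalCost q hq1 lam π T + stateMean q hq1 π H T := by
    intro T
    induction T with
    | zero => simp [totalCost]
    | succ n ih =>
      have h4 : totalCost q hq1 lam π (n + 1) = totalCost q hq1 lam π n +
        (expectedCost q hq1 lam (.noPacket 1) π n).toReal := Finset.sum_range_succ _ _
      have := hstep n
      rw [h4]
      push_cast
      linarith
  refine ⟨K, fun T => abs_le.2 ⟨?_, ?_⟩⟩
  · linarith [htel T, hpos 0, hbdd T]
  · linarith [htel T, hpos T, hK0]

end policy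

/-! ### Asymptotics -/

lemma tendsto_lower_bound (L B : ℝ) {q : ℝ} (hL : 0 ≤ L) :
    Tendsto (fun T : ℕ => (T * L - B - √(1 + T + 2 * (T * L)) / q) / T) atTop (𝓝 L) := by
  have h1 : Tendsto (fun T : ℕ => B / (T : ℝ)) atTop (𝓝 0) :=
    tendsto_const_div_atTop_nhds_zero_nat B
  have h2 : Tendsto (fun T : ℕ => √((1 / (T : ℝ) + 1 + 2 * L) * (1 / T)) / q) atTop (𝓝 0) := by
    have h3 : Tendsto (fun T : ℕ => 1 / (T : ℝ)) atTop (𝓝 0) :=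
      tendsto_const_div_atTop_nhds_zero_nat 1
    have h4 := ((((h3.add_const 1).add_const (2 * L)).mul h3).sqrt).div_const q
    simpa using h4
  have h5 := (h1.const_sub L).sub h2
  rw [sub_zero, sub_zero] at h5
  refine h5.congr' ?_
  filter_upwards [eventually_gt_atTop 0] with T hT
  have hT : (0 : ℝ) < T := by exact_mod_cast hT
  have : (1 / (T : ℝ) + 1 + 2 * L) * (1 / T) = (1 + T + 2 * (T * L)) / T ^ 2 := by
    field_simp
  rw [this, Real.sqrt_div (by positivity), Real.sqrt_sq hT.le]
  field_simp

/-- Mixing `f` with itself places the optimal stationary policy, up to an irrelevant coin, in the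
class over which the infimum is taken. -/
lemma averageCost_mixedPolicy_self (q : ℝ≥0) (hq1 : q ≤ 1) (lam p : ℝ≥0) (hp : p ≤ 1)
    (f : State → Action) :
    averageCost q hq1 lam (mixedPolicy p hp f f) =
      averageCost q hq1 lam (stationaryPolicy f) := by
  have hhist : ∀ b n, histLaw q hq1 (.noPacket 1) (mixedPolicy p hp f f) b n =
      histLaw q hq1 (.noPacket 1) (stationaryPolicy f) () n := by
    intro b n
    induction n with
    | zero => rfl
    | succ n ih =>
      simp only [histLaw, ih]
      simp only [mixedPolicy, stationaryPolicy, ite_self]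
  have hcost : ∀ n, expectedCost q hq1 lam (.noPacket 1) (mixedPolicy p hp f f) n =
      expectedCost q hq1 lam (.noPacket 1) (stationaryPolicy f) n := by
    intro n
    rw [expectedCost_eq, expectedCost_eq, expect_stateActionLaw, expect_stateActionLaw]
    simp only [hhist]
    simp only [mixedPolicy, stationaryPolicy, ite_self, expect_const, expect_pure]
  funext T
  simp only [averageCost, hcost]

end AgeSampling

/-! ### Optimality of the stationary policy -/

theorem mainTheorem4 (q : ℝ≥0) (hq0 : 0 < q) (hq1 : q ≤ 1) (lam : ℝ≥0) :
    ∃ (f : AgeSampling.State → AgeSampling.Action) (L : ℝ≥0),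
      Tendsto (AgeSampling.averageCost q hq1 lam (AgeSampling.stationaryPolicy f)) atTop
        (𝓝 (L : ℝ≥0∞)) ∧
      (L : ℝ≥0∞) = ⨅ π ∈ AgeSampling.bernoulliModulatedSimple,
        limsup (AgeSampling.averageCost q hq1 lam π) atTop ∧
      ∀ π : AgeSampling.Policy,
        (L : ℝ≥0∞) ≤ liminf (AgeSampling.averageCost q hq1 lam π) atTop := by
  obtain ⟨L, B, H, f, hL, hB, -, hHB, hle, heq⟩ :=
    AgeSampling.exists_optimality_equation hq0 hq1 lam
  have hlower : ∀ π : AgeSampling.Policy,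
      ENNReal.ofReal L ≤ liminf (AgeSampling.averageCost q hq1 lam π) atTop := by
    intro π
    rw [← (ENNReal.tendsto_ofReal
      (AgeSampling.tendsto_lower_bound L B (q := q) hL)).liminf_eq]
    refine liminf_le_liminf ?_
    filter_upwards [eventually_gt_atTop 0] with T hT
    rw [AgeSampling.averageCost_eq q hq1 lam π T hT]
    refine ENNReal.ofReal_le_ofReal ?_
    gcongr
    exact AgeSampling.le_totalCost hq1 π hq0 hL hB hHB hle T
  have hlim : Tendsto (AgeSampling.averageCost q hq1 lam (AgeSampling.stationaryPolicy f)) atTop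
      (𝓝 (ENNReal.ofReal L)) := by
    obtain ⟨K, hK⟩ := AgeSampling.totalCost_stationary hq1 hq0 hL hB hHB heq
    have h0 : Tendsto (fun T : ℕ => AgeSampling.totalCost q hq1 lam
        (AgeSampling.stationaryPolicy f) T / T) atTop (𝓝 L) := by
      rw [tendsto_iff_norm_sub_tendsto_zero]
      refine squeeze_zero' (.of_forall fun _ => norm_nonneg _) ?_
        (tendsto_const_div_atTop_nhds_zero_nat K)
      filter_upwards [eventually_gt_atTop 0] with T hT
      have hT : (0 : ℝ) < T := by exact_mod_cast hT
      rw [Real.norm_eq_abs, div_sub' hT.ne', abs_div, abs_of_pos hT]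
      gcongr
      exact hK T
    refine (ENNReal.tendsto_ofReal h0).congr' ?_
    filter_upwards [eventually_gt_atTop 0] with T hT
    rw [AgeSampling.averageCost_eq q hq1 lam _ T hT]
  refine ⟨f, L.toNNReal, hlim, le_antisymm ?_ ?_, hlower⟩
  · exact le_iInf₂ fun π _ => (hlower π).trans liminf_le_limsup
  -- The two components may coincide, so the exceptional state and the weight `1 / 2` are arbitrary
  -- choices.
  · refine (iInf₂_le (AgeSampling.mixedPolicy (1 / 2) (NNReal.half_lt_self one_ne_zero).le f f) ?_).trans ?_
    · exact ⟨1 / 2, by positivity, (NNReal.half_lt_self one_ne_zero), f, f, .noPacket 1,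
        fun _ _ => rfl, rfl⟩
    · rw [AgeSampling.averageCost_mixedPolicy_self, hlim.limsup_eq]
      rfl
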